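/- Let $\mathbb K$ be $\mathbb R$ or $\mathbb C$. For Banach spaces $X,Y$ over $\mathbb K$, let $\mathcal L(X,Y)$ be the space of bounded linear operators from $X$ to $Y$ with the operator norm, and let $\mathrm{RSE}(X,Y)$ be the set of all $T\in\mathcal L(X,Y)$ for which there is $x_0\in X$ with $\|x_0\|=1$ such that, whenever a sequence $(x_n)$ in the closed unit ball of $X$ satisfies $\|Tx_n\|\to\|T\|$, there are a subsequence $(x_{\sigma(n)})$ and $\theta\in\mathbb K$ with $|\theta|=1$ such that $Tx_{\sigma(n)}\to\theta\,Tx_0$ in norm. A measure $\mu$ is purely atomic if every measurable set of positive measure contains an atom of $\mu$, that is, a measurable set $A$ with $\mu(A)>0$ such that each measurable $B\subseteq A$ satisfies $\mu(B)=0$ or $\mu(A\setminus B)=0$. A Banach space $Y$ has the Radon–Nikodým property if for every finite measure space $(\Omega',\Sigma',\nu)$ and every countably additive vector measure $G\colon\Sigma'\to Y$ of bounded variation that is $\nu$-continuous (i.e. $G(E)=0$ whenever $\nu(E)=0$) there is a Bochner integrable $g\colon\Omega'\to Y$ with $G(E)=\int_E g\,d\nu$ for all $E\in\Sigma'$. **Theorem.**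 Let $(\Omega,\Sigma,\mu)$ be a finite measure space that is not purely atomic and let $Y$ be a Banach space over $\mathbb K$. If $\mathrm{RSE}(L_1(\mu),Y)$ is norm dense in $\mathcal L(L_1(\mu),Y)$, where $L_1(\mu)$ is the space of $\mathbb K$-valued integrable functions, then $Y$ has the Radon–Nikodým property. -/

import Mathlib

open MeasureTheory Filter Topology

universe u v w k

namespace RangeExposing

/-- The set `RSE(X, Y)` of range strongly exposing operators: there is `x₀` in the unit sphere of
`X` such that every sequence `x` in the closed unit ball with `‖T (x n)‖ → ‖T‖` has a subsequence
along which `T (x n)` converges to `θ • T x₀` for some modulus one scalar `θ`. -/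
def RSE (𝕜 X Y : Type*) [RCLike 𝕜] [NormedAddCommGroup X] [NormedSpace 𝕜 X]
    [NormedAddCommGroup Y] [NormedSpace 𝕜 Y] : Set (X →L[𝕜] Y) :=
  {T | ∃ x₀ : X, ‖x₀‖ = 1 ∧ ∀ x : ℕ → X, (∀ n, ‖x n‖ ≤ 1) →
    Tendsto (fun n => ‖T (x n)‖) atTop (𝓝 ‖T‖) →
    ∃ σ : ℕ → ℕ, StrictMono σ ∧ ∃ θ : 𝕜, ‖θ‖ = 1 ∧
      Tendsto (fun n => T (x (σ n))) atTop (𝓝 (θ • T x₀))}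

/-- A measurable set `A` of positive measure is an atom of `μ` if each of its measurable subsets
is null or has null complement in `A`. -/
def IsAtomSet {Ω : Type*} [MeasurableSpace Ω] (μ : Measure Ω) (A : Set Ω) : Prop :=
  MeasurableSet A ∧ 0 < μ A ∧
    ∀ B : Set Ω, MeasurableSet B → B ⊆ A → μ B = 0 ∨ μ (A \ B) = 0

/-- `μ` is purely atomic if every measurable set of positive measure contains an atom. -/
def PurelyAtomic {Ω : Type*} [MeasurableSpace Ω] (μ : Measure Ω) : Prop :=
  ∀ E : Set Ω, MeasurableSet E → 0 < μ E → ∃ A ⊆ E, IsAtomSet μ A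

/-- `Y` has the Radon–Nikodým property with respect to `μ`: each countably additive vector measure
`G` with values in `Y` which is `μ`-continuous and of bounded variation (that is, of finite total
variation on the whole space) has a Bochner integrable density with respect to `μ`. -/
def HasRNPWith (Y : Type*) [NormedAddCommGroup Y] [NormedSpace ℝ Y]
    {Ω : Type*} [MeasurableSpace Ω] (μ : Measure Ω) : Prop :=
  ∀ G : VectorMeasure Ω Y, (∀ E : Set Ω, MeasurableSet E → μ E = 0 → G E = 0) →
    G.variation Set.univ < ⊤ →
    ∃ g : Ω → Y, Integrable g μ ∧ ∀ E : Set Ω, MeasurableSet E → G E = ∫ t in E, g t ∂μ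

/-- `Y` has the Radon–Nikodým property: it has it with respect to every finite measure space
(with underlying set in an arbitrary universe `w`). -/
def HasRNP (Y : Type v) [NormedAddCommGroup Y] [NormedSpace ℝ Y] : Prop :=
  ∀ (Ω : Type w) [MeasurableSpace Ω] (μ : Measure Ω) [IsFiniteMeasure μ], HasRNPWith Y μ

end RangeExposing

/-!
# Denseness of range strongly exposing operators on `L₁(μ)` and the Radon–Nikodým property

The proof goes through a Radon–Nikodým property relative to one measure: `BoundedRNP Y μ` says that
each `Y`-valued vector measure `G` with `‖G E‖ ≤ μ E` has a Bochner integrable density.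

*Denseness gives `BoundedRNP Y μ`.* Let `T` be range strongly exposing. Two points `x`, `x'` of the
unit ball for which `‖T x + T x'‖` is almost `2 * ‖T‖` have images that are close to each other,
since these images accumulate at `θ • T x₀` and `θ' • T x₀` with `‖θ + θ'‖ = 2`, that is, `θ = θ'`
(`exists_norm_sub_le_of_mem_RSE`). If a normalised indicator function almost attains `‖T‖`, then the
Hahn decomposition theorem, applied after a norming functional, yields a set `B` of positive measure
such that `T` is almost norming, in the same direction, on the normalised indicator functions of all
subsets of `B`; hence the averages of `T` over subsets of `B` are close to each other. Given `G` and
a set `A` of positive measure, this is used for a range strongly exposing operator near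
`f ↦ ∫_A f dG`; such an operator can only be almost norming inside `A`. So each set of positive
measure contains one of positive measure on which the averages of `G` oscillate by at most `ε`
(`exists_subset_small_oscillation`), and exhaustion gives approximate densities with countably many
values, which are Cauchy in `L₁` (`boundedRNP_of_dense_RSE`).

*From `μ` to all finite measures.* `BoundedRNP` passes to restrictions, to multiples, and to image
measures (`BoundedRNP.map`). As `μ` is not purely atomic, every probability measure on the Cantor
space is, up to normalisation, an image of a restriction of `μ` to an atomless set
(`exists_map_eq_of_not_purelyAtomic`), so it satisfies `BoundedRNP`. For a general probability
measure `ν` this provides densities on all countably generated sub-σ-algebras. These densities form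
a martingale indexed by a family which is directed under countable unions, and Lévy's upward theorem
shows that they are eventually constant; the final value is a density on the whole σ-algebra
(`boundedRNP_of_cantor`). Finally, a `μ'`-continuous measure of bounded variation is dominated by
its variation, which has a density with respect to `μ'`.
-/

namespace RangeExposing

/-! ### Exhaustion and densities from approximate densities -/

/-- Exhaustion: if a hereditary property of measurable sets holds for null sets, and for some subset of
positive measure of each set of positive measure, then the space has a countable measurable
partition, given as the fibres of a function `g`, into sets with that property. -/
theorem exists_measurable_nat_fiber {Ω : Type*} [MeasurableSpace Ω] (μ : Measure Ω)
    [IsFiniteMeasure μ] (P : Set Ω → Prop)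
    (hmono : ∀ A B, MeasurableSet A → MeasurableSet B → A ⊆ B → P B → P A)
    (hnull : ∀ A, MeasurableSet A → μ A = 0 → P A)
    (hex : ∀ A, MeasurableSet A → 0 < μ A → ∃ B ⊆ A, MeasurableSet B ∧ 0 < μ B ∧ P B) :
    ∃ g : Ω → ℕ, Measurable g ∧ ∀ n, P (g ⁻¹' {n}) := by
  classical
  -- The measures of countable unions of sets with the property; the supremum is attained.
  let S : Set ENNReal :=
    {c | ∃ s : ℕ → Set Ω, (∀ n, MeasurableSet (s n) ∧ P (s n)) ∧ c = μ (⋃ n, s n)}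
  have hS : S.Nonempty :=
    ⟨_, fun _ => ∅, fun _ => ⟨.empty, hnull _ .empty measure_empty⟩, rfl⟩
  obtain ⟨c, -, hc, hcS⟩ := exists_seq_tendsto_sSup hS (OrderTop.bddAbove S)
  choose s hs hcs using hcS
  let t : ℕ → Set Ω := fun n => s n.unpair.1 n.unpair.2
  have ht : ∀ n, MeasurableSet (t n) ∧ P (t n) := fun n => hs _ _
  have hsup : sSup S ≤ μ (⋃ n, t n) := by
    refine le_of_tendsto' hc fun k => ?_
    rw [hcs]
    refine measure_mono (Set.iUnion_subset fun j => ?_)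
    have : s k j = t (Nat.pair k j) := by simp [t]
    rw [this]
    exact Set.subset_iUnion t _
  have htm : MeasurableSet (⋃ n, t n) := .iUnion fun n => (ht n).1
  have hcompl : μ (⋃ n, t n)ᶜ = 0 := by
    by_contra hne
    obtain ⟨B, hB, hBm, hB0, hPB⟩ := hex _ htm.compl (pos_iff_ne_zero.2 hne)
    have hmem : μ (⋃ n, t n) + μ B ∈ S := by
      refine ⟨fun n => Nat.casesOn n B t, ?_, ?_⟩
      · rintro (_ | n)
        exacts [⟨hBm, hPB⟩, ht n]
      · rw [← measure_union (Set.subset_compl_iff_disjoint_left.1 hB) hBm, Set.union_comm]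
        congr 1
        ext x
        simp only [Set.mem_union, Set.mem_iUnion]
        constructor
        · rintro (h | ⟨i, h⟩)
          exacts [⟨0, h⟩, ⟨i + 1, h⟩]
        · rintro ⟨_ | i, h⟩
          exacts [Or.inl h, Or.inr ⟨i, h⟩]
    have := (le_sSup hmem).trans hsup
    exact absurd this (not_le.2 (ENNReal.lt_add_right (measure_ne_top _ _) hB0.ne'))
  let r : ℕ → Set Ω := fun n => Nat.casesOn (motive := fun _ => Set Ω) n (⋃ n, t n)ᶜ t
  have hr : ∀ n, MeasurableSet (r n) ∧ P (r n) := by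
    rintro (_ | n)
    exacts [⟨htm.compl, hnull _ htm.compl hcompl⟩, ht n]
  have hcov : ∀ x, ∃ n, x ∈ r n := by
    intro x
    by_cases hx : x ∈ ⋃ n, t n
    · obtain ⟨n, hn⟩ := Set.mem_iUnion.1 hx
      exact ⟨n + 1, hn⟩
    · exact ⟨0, hx⟩
  have hg : Measurable fun x : Ω => Nat.find (p := fun n : ℕ => x ∈ r n) (hcov x) :=
    measurable_find (p := fun (x : Ω) (n : ℕ) => x ∈ r n) hcov fun k => (hr k).1
  refine ⟨_, hg, fun n => hmono _ (r n) (hg (measurableSet_singleton n)) (hr n).1 ?_ (hr n).2⟩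
  rintro x rfl
  exact Nat.find_spec (p := fun n : ℕ => x ∈ r n) (hcov x)

/-- A bound for the integrals of `h` over all measurable sets bounds the norm of `h` in `L₁`, because
the variation of the vector measure with density `h` has density `‖h‖`. -/
theorem integral_norm_le_of_forall_norm_setIntegral_le {Ω Y : Type*} [MeasurableSpace Ω]
    [NormedAddCommGroup Y] [NormedSpace ℝ Y] [CompleteSpace Y] {μ : Measure Ω}
    [IsFiniteMeasure μ] {h : Ω → Y} (hh : Integrable h μ) {ε : ℝ} (hε : 0 ≤ ε)
    (hle : ∀ E, MeasurableSet E → ‖∫ t in E, h t ∂μ‖ ≤ ε * μ.real E) :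
    ∫ t, ‖h t‖ ∂μ ≤ ε * μ.real Set.univ := by
  have hv : (μ.withDensityᵥ h).variation ≤ ENNReal.ofReal ε • μ := by
    refine VectorMeasure.variation_le_of_forall_enorm_le fun E hE => ?_
    rw [withDensityᵥ_apply hh hE, ← ofReal_norm, Measure.smul_apply, smul_eq_mul,
      ← ofReal_measureReal (μ := μ) (s := E), ← ENNReal.ofReal_mul hε]
    exact ENNReal.ofReal_le_ofReal (hle E hE)
  rw [Measure.variation_withDensityᵥ hh] at hv
  have := hv Set.univ
  rw [withDensity_apply _ .univ, Measure.restrict_univ, Measure.smul_apply, smul_eq_mul] at this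
  rw [integral_norm_eq_lintegral_enorm hh.1]
  refine (ENNReal.toReal_mono (by finiteness) this).trans ?_
  rw [ENNReal.toReal_mul, ENNReal.toReal_ofReal hε, measureReal_def]

/-- The Radon–Nikodým property of `Y` with respect to `μ` for the vector measures that are dominated
by `μ` itself: these correspond to the operators of norm at most one from `L₁(μ)` to `Y`. -/
def BoundedRNP (Y : Type*) [NormedAddCommGroup Y] [NormedSpace ℝ Y] {Ω : Type*}
    [MeasurableSpace Ω] (μ : Measure Ω) : Prop :=
  ∀ G : VectorMeasure Ω Y, (∀ E, ‖G E‖ₑ ≤ μ E) →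
    ∃ g : Ω → Y, Integrable g μ ∧ ∀ E, MeasurableSet E → G E = ∫ t in E, g t ∂μ

/-- A set function which is approximated, uniformly relative to `μ`, by indefinite integrals is itself
an indefinite integral, because the approximate densities are Cauchy in `L₁`. -/
theorem exists_density_of_forall_approx {Ω Y : Type*} [MeasurableSpace Ω]
    [NormedAddCommGroup Y] [NormedSpace ℝ Y] [CompleteSpace Y] {μ : Measure Ω}
    [IsFiniteMeasure μ] (G : Set Ω → Y)
    (happ : ∀ ε : ℝ, 0 < ε → ∃ h : Ω → Y, Integrable h μ ∧
      ∀ E, MeasurableSet E → ‖G E - ∫ t in E, h t ∂μ‖ ≤ ε * μ.real E) :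
    ∃ g : Ω → Y, Integrable g μ ∧ ∀ E, MeasurableSet E → G E = ∫ t in E, g t ∂μ := by
  have hpos : ∀ n : ℕ, (0 : ℝ) < 1 / (n + 1) := fun n => by positivity
  choose h hint hh using fun n : ℕ => happ _ (hpos n)
  have hdist : ∀ m n, dist ((hint m).toL1 (h m)) ((hint n).toL1 (h n)) ≤
      (1 / ((m : ℝ) + 1) + 1 / ((n : ℝ) + 1)) * μ.real Set.univ := by
    intro m n
    rw [dist_eq_norm, ← Integrable.toL1_sub, L1.norm_of_fun_eq_integral_norm]
    refine integral_norm_le_of_forall_norm_setIntegral_le ((hint m).sub (hint n))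
      (by positivity) fun E hE => ?_
    simp only [Pi.sub_apply]
    rw [integral_sub (hint m).integrableOn (hint n).integrableOn]
    have := norm_sub_le (G E - ∫ t in E, h n t ∂μ) (G E - ∫ t in E, h m t ∂μ)
    rw [sub_sub_sub_cancel_left] at this
    linarith [hh m E hE, hh n E hE]
  have hz : Tendsto (fun n : ℕ => 1 / ((n : ℝ) + 1)) atTop (𝓝 0) :=
    tendsto_one_div_add_atTop_nhds_zero_nat
  have hcau : CauchySeq fun n => (hint n).toL1 (h n) := by
    refine cauchySeq_of_le_tendsto_0' (fun n : ℕ => 2 * (1 / ((n : ℝ) + 1)) * μ.real Set.univ)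
      (fun m n hmn => (hdist m n).trans ?_) ?_
    · have : 1 / ((n : ℝ) + 1) ≤ 1 / ((m : ℝ) + 1) :=
        one_div_le_one_div_of_le (by positivity) (by exact_mod_cast Nat.succ_le_succ hmn)
      gcongr
      linarith
    · simpa using (hz.const_mul 2).mul_const (μ.real Set.univ)
  obtain ⟨g, hg⟩ := cauchySeq_tendsto_of_complete hcau
  refine ⟨g, L1.integrable_coeFn g, fun E hE => ?_⟩
  have h1 : Tendsto (fun n => ∫ t in E, h n t ∂μ) atTop (𝓝 (∫ t in E, g t ∂μ)) := by
    have := ((continuous_setIntegral E).tendsto g).comp hg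
    refine this.congr fun n => ?_
    exact setIntegral_congr_ae hE ((hint n).coeFn_toL1.mono fun x hx _ => hx)
  refine tendsto_nhds_unique ?_ h1
  rw [tendsto_iff_norm_sub_tendsto_zero]
  refine squeeze_zero (fun _ => norm_nonneg _) (fun n => ?_)
    (by simpa only [zero_mul] using hz.mul_const (μ.real E))
  rw [norm_sub_rev]
  exact hh n E hE

/-! ### Range strongly exposing operators and operators on `L₁` -/

/-- A range strongly exposing operator is uniformly convex near its norm: points of the unit ball
whose images have an almost norming sum have images close to each other. -/
theorem exists_norm_sub_le_of_mem_RSE {𝕜 X Y : Type*} [RCLike 𝕜] [NormedAddCommGroup X]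
    [NormedSpace 𝕜 X] [NormedAddCommGroup Y] [NormedSpace 𝕜 Y] {T : X →L[𝕜] Y}
    (hT : T ∈ RSE 𝕜 X Y) {ε : ℝ} (hε : 0 < ε) :
    ∃ δ : ℝ, 0 < δ ∧ ∀ x x' : X, ‖x‖ ≤ 1 → ‖x'‖ ≤ 1 → 2 * (‖T‖ - δ) ≤ ‖T x + T x'‖ →
      ‖T x - T x'‖ ≤ ε := by
  obtain ⟨x₀, hx₀, hseq⟩ := hT
  by_contra! hcon
  choose x x' hx hx' hsum hsub using fun n : ℕ => hcon (1 / ((n : ℝ) + 1)) (by positivity)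
  have hz : Tendsto (fun n : ℕ => 1 / ((n : ℝ) + 1)) atTop (𝓝 0) :=
    tendsto_one_div_add_atTop_nhds_zero_nat
  have hle : ∀ z : X, ‖z‖ ≤ 1 → ‖T z‖ ≤ ‖T‖ := fun z hz => T.unit_le_opNorm z hz
  have hnorm : ∀ u v : ℕ → X, (∀ n, ‖u n‖ ≤ 1) → (∀ n, ‖v n‖ ≤ 1) →
      (∀ n : ℕ, 2 * (‖T‖ - 1 / ((n : ℝ) + 1)) ≤ ‖T (u n) + T (v n)‖) →
      Tendsto (fun n => ‖T (u n)‖) atTop (𝓝 ‖T‖) := by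
    intro u v hu hv huv
    have hlow : Tendsto (fun n : ℕ => ‖T‖ - 2 * (1 / ((n : ℝ) + 1))) atTop (𝓝 ‖T‖) := by
      simpa using (hz.const_mul 2).const_sub ‖T‖
    refine tendsto_of_tendsto_of_tendsto_of_le_of_le hlow tendsto_const_nhds (fun n => ?_)
      fun n => hle _ (hu n)
    have h1 := huv n
    have h2 := norm_add_le (T (u n)) (T (v n))
    have h3 := hle _ (hv n)
    simp only
    linarith
  obtain ⟨σ, hσ, θ, hθ, hlim⟩ := hseq x hx (hnorm x x' hx hx' hsum)
  obtain ⟨τ, hτ, θ', hθ', hlim'⟩ := hseq (x' ∘ σ) (fun n => hx' _)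
    ((hnorm x' x hx' hx fun n => (hsum n).trans_eq (by rw [add_comm])).comp hσ.tendsto_atTop)
  have hστ : Tendsto (fun n => σ (τ n)) atTop atTop := hσ.tendsto_atTop.comp hτ.tendsto_atTop
  have hlim2 : Tendsto (fun n => T (x (σ (τ n)))) atTop (𝓝 (θ • T x₀)) :=
    hlim.comp hτ.tendsto_atTop
  have hlim3 : Tendsto (fun n => T (x' (σ (τ n)))) atTop (𝓝 (θ' • T x₀)) := hlim'
  -- In the limit `‖θ + θ'‖ = 2`, hence `θ = θ'`, while `‖(θ - θ') • T x₀‖ ≥ ε`.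
  have hS : 2 * ‖T‖ ≤ ‖θ + θ'‖ * ‖T x₀‖ := by
    rw [← norm_smul, add_smul]
    have hlow : Tendsto (fun n => 2 * (‖T‖ - 1 / ((σ (τ n) : ℝ) + 1))) atTop (𝓝 (2 * ‖T‖)) := by
      simpa using ((hz.comp hστ).const_sub ‖T‖).const_mul 2
    exact le_of_tendsto_of_tendsto' hlow (hlim2.add hlim3).norm fun n => hsum _
  have hD : ε ≤ ‖θ - θ'‖ * ‖T x₀‖ := by
    rw [← norm_smul, sub_smul]
    exact ge_of_tendsto' (hlim2.sub hlim3).norm fun n => (hsub _).le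
  have hT0 : 0 < ‖T x₀‖ := by
    by_contra h
    have : ‖T x₀‖ = 0 := le_antisymm (not_lt.1 h) (norm_nonneg _)
    rw [this, mul_zero] at hD
    exact absurd hD (not_le.2 hε)
  have h2 : 2 ≤ ‖θ + θ'‖ := by
    have := hle x₀ hx₀.le
    by_contra h
    nlinarith
  have hpar := parallelogram_law_with_norm 𝕜 θ θ'
  rw [hθ, hθ'] at hpar
  have h0 : ‖θ - θ'‖ = 0 := by nlinarith [norm_nonneg (θ - θ')]
  rw [h0, zero_mul] at hD
  exact absurd hD (not_le.2 hε)

section L1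

variable {𝕜 Ω Y : Type*} [RCLike 𝕜] [MeasurableSpace Ω] {μ : Measure Ω} [IsFiniteMeasure μ]
  [NormedAddCommGroup Y]

variable (𝕜 μ) in
/-- The indicator function of a measurable set `E`, as an element of `L₁(μ)` over `𝕜`. -/
noncomputable def oneOn {E : Set Ω} (hE : MeasurableSet E) : Lp 𝕜 1 μ :=
  indicatorConstLp 1 hE (measure_ne_top μ E) (1 : 𝕜)

theorem norm_oneOn {E : Set Ω} (hE : MeasurableSet E) : ‖oneOn 𝕜 μ hE‖ = μ.real E := by
  simp [oneOn, norm_indicatorConstLp one_ne_zero ENNReal.one_ne_top]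

theorem oneOn_union {E F : Set Ω} (hE : MeasurableSet E) (hF : MeasurableSet F)
    (hEF : Disjoint E F) : oneOn 𝕜 μ (hE.union hF) = oneOn 𝕜 μ hE + oneOn 𝕜 μ hF :=
  indicatorConstLp_disjoint_union hE hF _ _ hEF _

/-- The norm of an operator on `L₁(μ)` is determined by its values at indicator functions. -/
theorem opNorm_le_of_forall_oneOn [NormedSpace 𝕜 Y] (T : Lp 𝕜 1 μ →L[𝕜] Y) {C : ℝ} (hC : 0 ≤ C)
    (h : ∀ E (hE : MeasurableSet E), ‖T (oneOn 𝕜 μ hE)‖ ≤ C * μ.real E) : ‖T‖ ≤ C := by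
  refine T.opNorm_le_bound hC fun f => ?_
  refine Lp.induction ENNReal.one_ne_top (motive := fun f => ‖T f‖ ≤ C * ‖f‖) ?_ ?_ ?_ f
  · intro c E hE hμE
    have : (Lp.simpleFunc.indicatorConst 1 hE hμE.ne c : Lp 𝕜 1 μ) = c • oneOn 𝕜 μ hE := by
      rw [Lp.simpleFunc.coe_indicatorConst, oneOn, indicatorConstLp, indicatorConstLp,
        ← MemLp.toLp_const_smul]
      congr 1
      ext x
      by_cases hx : x ∈ E <;> simp [hx]
    rw [this, map_smul, norm_smul, norm_smul, norm_oneOn]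
    have := mul_le_mul_of_nonneg_left (h E hE) (norm_nonneg c)
    linarith
  · intro f g hf hg hdisj hTf hTg
    have : ‖hf.toLp f + hg.toLp g‖ = ‖hf.toLp f‖ + ‖hg.toLp g‖ := by
      rw [← MemLp.toLp_add]
      simp only [L1.norm_eq_integral_norm]
      rw [← integral_add (L1.integrable_coeFn _).norm (L1.integrable_coeFn _).norm]
      refine integral_congr_ae ?_
      filter_upwards [(hf.add hg).coeFn_toLp, hf.coeFn_toLp, hg.coeFn_toLp] with x h1 h2 h3
      rw [h1, h2, h3, Pi.add_apply]
      by_cases hx : f x = 0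
      · simp [hx]
      · have : g x = 0 := by
          by_contra hgx
          exact Set.disjoint_left.1 hdisj hx hgx
        simp [this]
    rw [map_add, this, mul_add]
    exact (norm_add_le _ _).trans (add_le_add hTf hTg)
  · exact isClosed_le (T.continuous.norm) (continuous_const.mul continuous_norm)

theorem exists_vectorMeasure_apply_oneOn [NormedSpace ℝ Y] [CompleteSpace Y]
    (T : Lp 𝕜 1 μ →L[ℝ] Y) :
    ∃ V : VectorMeasure Ω Y, ∀ E (hE : MeasurableSet E), V E = T (oneOn 𝕜 μ hE) := by
  classical
  have : IsFiniteMeasure (ENNReal.ofReal ‖T‖ • μ) := μ.smul_finite ENNReal.ofReal_ne_top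
  refine ⟨VectorMeasure.of_additive_of_le_measure (μ := ENNReal.ofReal ‖T‖ • μ)
    (fun E => if hE : MeasurableSet E then T (oneOn 𝕜 μ hE) else 0) (fun E => ?_) ?_ ?_, ?_⟩
  · split_ifs with hE
    · rw [← ofReal_norm, Measure.smul_apply, smul_eq_mul, ← ofReal_measureReal (μ := μ) (s := E),
        ← ENNReal.ofReal_mul (norm_nonneg T), ← norm_oneOn (𝕜 := 𝕜) hE]
      exact ENNReal.ofReal_le_ofReal (T.le_opNorm _)
    · simp
  · intro E F hE hF hEF
    simp only [hE, hF, hE.union hF, dif_pos]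
    rw [oneOn_union hE hF hEF, map_add]
  · intro E hE
    simp [hE]
  · intro E hE
    change (if hE : MeasurableSet E then T (oneOn 𝕜 μ hE) else 0) = _
    rw [dif_pos hE]

/-- The operator `f ↦ ∫ f dG` on `L₁(μ)`, for a vector measure `G` dominated by `μ`. -/
theorem exists_clm_oneOn [NormedSpace ℝ Y] [NormedSpace 𝕜 Y] [IsScalarTower ℝ 𝕜 Y]
    [CompleteSpace Y] (G : VectorMeasure Ω Y) (hG : ∀ E, ‖G E‖ₑ ≤ μ E) :
    ∃ S : Lp 𝕜 1 μ →L[𝕜] Y, ‖S‖ ≤ 1 ∧ ∀ E (hE : MeasurableSet E), S (oneOn 𝕜 μ hE) = G E := by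
  let F : Set Ω → 𝕜 →L[ℝ] Y := fun E =>
    (ContinuousLinearMap.toSpanSingleton 𝕜 (G E)).restrictScalars ℝ
  have hF : DominatedFinMeasAdditive μ F 1 := by
    refine ⟨fun s t hs ht _ _ hst => ?_, fun s hs _ => ?_⟩
    · ext
      simp [F, VectorMeasure.of_union hst hs ht]
    · rw [one_mul]
      simp only [F, ContinuousLinearMap.norm_restrictScalars,
        ContinuousLinearMap.norm_toSpanSingleton]
      have := hG s
      rw [← ofReal_norm, ← ofReal_measureReal] at this
      exact (ENNReal.ofReal_le_ofReal_iff measureReal_nonneg).1 this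
  have hsm : ∀ c : 𝕜, ∀ s x, F s (c • x) = c • F s x := by
    intro c s x
    simp [F, mul_smul]
  have happ : ∀ E (hE : MeasurableSet E), L1.setToL1' 𝕜 hF hsm (oneOn 𝕜 μ hE) = G E := by
    intro E hE
    rw [← L1.setToL1_eq_setToL1' hF hsm, oneOn, L1.setToL1_indicatorConstLp hF hE]
    simp [F]
  refine ⟨L1.setToL1' 𝕜 hF hsm, opNorm_le_of_forall_oneOn _ zero_le_one fun E hE => ?_, happ⟩
  rw [happ, one_mul]
  have := hG E
  rw [← ofReal_norm, ← ofReal_measureReal] at this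
  exact (ENNReal.ofReal_le_ofReal_iff measureReal_nonneg).1 this

end L1

/-! ### Denseness of range strongly exposing operators gives densities -/

section Denseness

variable {𝕜 Ω Y : Type*} [RCLike 𝕜] [MeasurableSpace Ω] {μ : Measure Ω} [IsFiniteMeasure μ]
  [NormedAddCommGroup Y]

/-- If a real functional on `L₁(μ)` has average greater than `c` over `A`, then `A` has a subset of
positive measure such that the average over each of its subsets is at least `c`. This is the Hahn
decomposition for the signed measure `C ↦ c * μ C - ψ 1_C`. -/
theorem exists_subset_forall_le {ψ : Lp 𝕜 1 μ →L[ℝ] ℝ} {c : ℝ} {A : Set Ω}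
    (hA : MeasurableSet A) (h : c * μ.real A < ψ (oneOn 𝕜 μ hA)) :
    ∃ B ⊆ A, MeasurableSet B ∧ 0 < μ B ∧
      ∀ C ⊆ B, ∀ hC : MeasurableSet C, c * μ.real C ≤ ψ (oneOn 𝕜 μ hC) := by
  obtain ⟨V, hV⟩ := exists_vectorMeasure_apply_oneOn ψ
  let s : SignedMeasure Ω := c • μ.toSignedMeasure - V
  have hs : ∀ E (hE : MeasurableSet E), s E = c * μ.real E - ψ (oneOn 𝕜 μ hE) := by
    intro E hE
    simp [s, hV E hE, Measure.toSignedMeasure_apply_measurable hE]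
  obtain ⟨B, hB, hBA, hneg, hlt⟩ := s.exists_subset_restrict_nonpos (i := A) (by
    rw [hs A hA]; linarith)
  refine ⟨B, hBA, hB, pos_iff_ne_zero.2 fun h0 => ?_, fun C hC hCm => ?_⟩
  · have h1 : μ.real B = 0 := by simp [measureReal_def, h0]
    have h2 : oneOn 𝕜 μ hB = 0 := by rw [← norm_eq_zero, norm_oneOn, h1]
    rw [hs B hB, h1, h2, map_zero] at hlt
    simp at hlt
  · have := VectorMeasure.subset_le_of_restrict_le_restrict _ _ hB hneg hC
    rw [hs C hCm] at this
    simp only [FunLike.coe_zero, Pi.zero_apply] at this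
    linarith

/-- If a range strongly exposing operator `T` almost attains its norm at the normalised indicator
function of `A`, then `A` has a subset of positive measure over whose subsets the averages of `T`
are all close to one vector `y`. -/
theorem exists_subset_small_oscillation_of_mem_RSE [NormedSpace ℝ Y] [NormedSpace 𝕜 Y]
    [IsScalarTower ℝ 𝕜 Y] {T : Lp 𝕜 1 μ →L[𝕜] Y} (hT : T ∈ RSE 𝕜 (Lp 𝕜 1 μ) Y) {ε : ℝ}
    (hε : 0 < ε) : ∃ δ : ℝ, 0 < δ ∧ ∀ A (hA : MeasurableSet A),
      (‖T‖ - δ) * μ.real A < ‖T (oneOn 𝕜 μ hA)‖ →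
      ∃ B ⊆ A, MeasurableSet B ∧ 0 < μ B ∧ ∃ y : Y, ‖y‖ ≤ ‖T‖ ∧
        ∀ C ⊆ B, ∀ hC : MeasurableSet C,
          ‖T (oneOn 𝕜 μ hC) - μ.real C • y‖ ≤ ε * μ.real C := by
  obtain ⟨δ, hδ, hclose⟩ := exists_norm_sub_le_of_mem_RSE hT hε
  refine ⟨δ, hδ, fun A hA hlt => ?_⟩
  obtain ⟨f, hf1, hf⟩ := exists_dual_vector'' 𝕜 (T (oneOn 𝕜 μ hA))
  let ψ : Lp 𝕜 1 μ →L[ℝ] ℝ := RCLike.reCLM.comp ((f.comp T).restrictScalars ℝ)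
  have hψ : ∀ x, ψ x = RCLike.re (f (T x)) := fun x => rfl
  have hψA : ψ (oneOn 𝕜 μ hA) = ‖T (oneOn 𝕜 μ hA)‖ := by rw [hψ, hf]; simp
  obtain ⟨B, hBA, hB, hB0, hle⟩ := exists_subset_forall_le (ψ := ψ) hA (hψA ▸ hlt)
  -- The normalised indicator functions of the subsets of `B`.
  let e : ∀ C, MeasurableSet C → Lp 𝕜 1 μ := fun C hC => (μ.real C)⁻¹ • oneOn 𝕜 μ hC
  have hTe : ∀ C (hC : MeasurableSet C), T (e C hC) = (μ.real C)⁻¹ • T (oneOn 𝕜 μ hC) :=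
    fun C hC => (T.restrictScalars ℝ).map_smul _ _
  have he : ∀ C (hC : MeasurableSet C), ‖e C hC‖ ≤ 1 := by
    intro C hC
    simp only [e]
    rw [norm_smul, norm_oneOn, norm_inv, Real.norm_of_nonneg measureReal_nonneg]
    exact inv_mul_le_one
  have hψe : ∀ C ⊆ B, ∀ hC : MeasurableSet C, 0 < μ.real C → ‖T‖ - δ ≤ ψ (e C hC) := by
    intro C hCB hC hC0
    have := hle C hCB hC
    simp only [e]
    rw [map_smul, smul_eq_mul, le_inv_mul_iff₀ hC0]
    linarith
  have hBr : 0 < μ.real B := ENNReal.toReal_pos hB0.ne' (measure_ne_top _ _)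
  refine ⟨B, hBA, hB, hB0, T (e B hB), T.unit_le_opNorm _ (he B hB), fun C hCB hC => ?_⟩
  rcases (measureReal_nonneg (μ := μ) (s := C)).eq_or_lt with h0 | h0
  · have h2 : oneOn 𝕜 μ hC = 0 := by rw [← norm_eq_zero, norm_oneOn, ← h0]
    simp [h2, ← h0]
  · have hsum : 2 * (‖T‖ - δ) ≤ ‖T (e C hC) + T (e B hB)‖ := by
      have h1 := hψe C hCB hC h0
      have h2 := hψe B subset_rfl hB hBr
      have h3 : ψ (e C hC + e B hB) ≤ ‖T (e C hC) + T (e B hB)‖ := by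
        rw [hψ, map_add]
        refine (RCLike.re_le_norm _).trans ((f.le_opNorm _).trans ?_)
        exact mul_le_of_le_one_left (norm_nonneg _) hf1
      rw [map_add] at h3
      linarith
    have hfin := hclose _ _ (he C hC) (he B hB) hsum
    have : T (oneOn 𝕜 μ hC) = μ.real C • T (e C hC) := by
      rw [hTe, smul_inv_smul₀ h0.ne']
    rw [this, ← smul_sub, norm_smul, Real.norm_of_nonneg h0.le, mul_comm]
    gcongr

/-- If the range strongly exposing operators are dense, then each set of positive measure has a subset
of positive measure over whose subsets the averages of `G` are all close to one vector `y`. The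
bound on `‖y‖`, uniform in the sets, makes step functions with such values integrable. -/
theorem exists_subset_small_oscillation [NormedSpace ℝ Y] [NormedSpace 𝕜 Y]
    [IsScalarTower ℝ 𝕜 Y] [CompleteSpace Y] (hdense : Dense (RSE 𝕜 (Lp 𝕜 1 μ) Y))
    (G : VectorMeasure Ω Y) (hG : ∀ E, ‖G E‖ₑ ≤ μ E) {ε : ℝ} (hε : 0 < ε) {A : Set Ω}
    (hA : MeasurableSet A) (hA0 : 0 < μ A) :
    ∃ B ⊆ A, MeasurableSet B ∧ 0 < μ B ∧ ∃ y : Y, ‖y‖ ≤ 2 ∧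
      ∀ C ⊆ B, MeasurableSet C → ‖G C - μ.real C • y‖ ≤ ε * μ.real C := by
  obtain ⟨S, hS1, hS⟩ := exists_clm_oneOn (𝕜 := 𝕜) (μ := μ) (G.restrict A) (fun E => by
    by_cases hE : MeasurableSet E
    · rw [G.restrict_apply hA hE]
      exact (hG _).trans (measure_mono Set.inter_subset_left)
    · simp [VectorMeasure.not_measurable _ hE])
  have hSA : ∀ C ⊆ A, ∀ hC : MeasurableSet C, S (oneOn 𝕜 μ hC) = G C := by
    intro C hCA hC
    rw [hS, G.restrict_apply hA hC, Set.inter_eq_left.2 hCA]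
  rcases (norm_nonneg S).eq_or_lt with hS0 | hS0
  · refine ⟨A, subset_rfl, hA, hA0, 0, by simp, fun C hCA hC => ?_⟩
    have hSz : S = 0 := norm_eq_zero.1 hS0.symm
    rw [← hSA C hCA hC, hSz]
    simp only [zero_apply, smul_zero, sub_zero, norm_zero]
    positivity
  -- The perturbation is small compared to `‖S‖`, so that its norm is almost attained inside `A`.
  let η : ℝ := min (min (ε / 2) 1) (‖S‖ / 4)
  have hη : 0 < η := by positivity
  have hηε : η ≤ ε / 2 := (min_le_left _ _).trans (min_le_left _ _)
  have hη1 : η ≤ 1 := (min_le_left _ _).trans (min_le_right _ _)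
  have hηS : η ≤ ‖S‖ / 4 := min_le_right _ _
  obtain ⟨T, hT, hST⟩ := hdense.exists_dist_lt S hη
  rw [dist_eq_norm] at hST
  have hTS : ∀ C (hC : MeasurableSet C),
      ‖S (oneOn 𝕜 μ hC) - T (oneOn 𝕜 μ hC)‖ ≤ η * μ.real C := by
    intro C hC
    rw [← sub_apply, ← norm_oneOn (𝕜 := 𝕜) hC]
    exact (S - T).le_of_opNorm_le hST.le _
  have hTlow : ‖S‖ - η ≤ ‖T‖ := by
    have := norm_sub_norm_le S T
    linarith
  have hTup : ‖T‖ ≤ 2 := by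
    have := norm_sub_norm_le T S
    rw [norm_sub_rev] at this
    linarith
  obtain ⟨δ₀, hδ₀, hosc⟩ := exists_subset_small_oscillation_of_mem_RSE hT (half_pos hε)
  let δ : ℝ := min δ₀ (‖S‖ / 4)
  have hδ : 0 < δ := by positivity
  have hδδ₀ : δ ≤ δ₀ := min_le_left _ _
  have hδS : δ ≤ ‖S‖ / 4 := min_le_right _ _
  -- An almost norming set `E`. As `S` vanishes off `A`, `T` has norm at most `η < ‖T‖ - δ` there, so
  -- `E ∩ A` is almost norming as well.
  obtain ⟨E, hE, hEbig⟩ : ∃ E, ∃ hE : MeasurableSet E,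
      (‖T‖ - δ) * μ.real E < ‖T (oneOn 𝕜 μ hE)‖ := by
    by_contra! hcon
    have := opNorm_le_of_forall_oneOn T (by linarith) hcon
    linarith
  have hEA : MeasurableSet (E ∩ A) := hE.inter hA
  have hEd : MeasurableSet (E \ A) := hE.diff hA
  have hEAbig : (‖T‖ - δ₀) * μ.real (E ∩ A) < ‖T (oneOn 𝕜 μ hEA)‖ := by
    have hsplit : oneOn 𝕜 μ hE = oneOn 𝕜 μ hEA + oneOn 𝕜 μ hEd := by
      rw [← oneOn_union hEA hEd (Set.disjoint_sdiff_inter.symm)]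
      congr 1
      exact (Set.inter_union_sdiff E A).symm
    have hzero : S (oneOn 𝕜 μ hEd) = 0 := by
      rw [hS, G.restrict_apply hA hEd, Set.sdiff_inter_self, VectorMeasure.empty]
    have h1 := hTS _ hEd
    rw [hzero, zero_sub, norm_neg] at h1
    rw [hsplit, map_add, ← measureReal_inter_add_sdiff (s := E) hA] at hEbig
    have h2 := norm_add_le (T (oneOn 𝕜 μ hEA)) (T (oneOn 𝕜 μ hEd))
    have h3 : η * μ.real (E \ A) ≤ (‖T‖ - δ) * μ.real (E \ A) := by
      gcongr
      linarith
    have h4 : (‖T‖ - δ₀) * μ.real (E ∩ A) ≤ (‖T‖ - δ) * μ.real (E ∩ A) := by gcongr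
    linarith
  obtain ⟨B, hBE, hB, hB0, y, hy, hle⟩ := hosc _ hEA hEAbig
  have hBA : B ⊆ A := hBE.trans Set.inter_subset_right
  refine ⟨B, hBA, hB, hB0, y, hy.trans hTup, fun C hCB hC => ?_⟩
  rw [← hSA C (hCB.trans hBA) hC]
  have h1 := hle C hCB hC
  have h2 := hTS C hC
  have h3 := norm_add_le (S (oneOn 𝕜 μ hC) - T (oneOn 𝕜 μ hC))
    (T (oneOn 𝕜 μ hC) - μ.real C • y)
  rw [sub_add_sub_cancel] at h3
  have h4 : η * μ.real C ≤ ε / 2 * μ.real C := by gcongr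
  linarith

theorem boundedRNP_of_dense_RSE [NormedSpace ℝ Y] [NormedSpace 𝕜 Y]
    [IsScalarTower ℝ 𝕜 Y] [CompleteSpace Y] (hdense : Dense (RSE 𝕜 (Lp 𝕜 1 μ) Y)) :
    BoundedRNP Y μ := by
  intro G hG
  refine exists_density_of_forall_approx G fun ε hε => ?_
  obtain ⟨g, hg, hP⟩ := exists_measurable_nat_fiber μ
    (fun B => ∃ y : Y, ‖y‖ ≤ 2 ∧
      ∀ C ⊆ B, MeasurableSet C → ‖G C - μ.real C • y‖ ≤ ε * μ.real C)
    (fun A B _ _ hAB ⟨y, hy, h⟩ => ⟨y, hy, fun C hC => h C (hC.trans hAB)⟩)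
    (fun A _ hA0 => ⟨0, by simp, fun C hC _ => by
      have h0 : μ C = 0 := measure_mono_null hC hA0
      have : G C = 0 := by simpa [h0] using hG C
      simp [this, measureReal_def, h0]⟩)
    (fun A hA hA0 => exists_subset_small_oscillation hdense G hG hε hA hA0)
  choose y hy hle using hP
  have hyg : StronglyMeasurable fun t => y (g t) :=
    (StronglyMeasurable.of_discrete (f := y)).comp_measurable hg
  have hint : Integrable (fun t => y (g t)) μ :=
    Integrable.of_bound hyg.aestronglyMeasurable 2 (.of_forall fun t => hy _)
  refine ⟨_, hint, fun E hE => ?_⟩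
  have hm : ∀ n, MeasurableSet (E ∩ g ⁻¹' {n}) := fun n => hE.inter (hg (measurableSet_singleton n))
  have hd : Pairwise (Function.onFun Disjoint fun n => E ∩ g ⁻¹' {n}) := by
    intro m n hmn
    refine Set.disjoint_left.2 fun x hx hx' => hmn ?_
    rw [← hx.2, ← hx'.2]
  have hU : ⋃ n, E ∩ g ⁻¹' {n} = E := by
    ext x
    simp
  have h1 : HasSum (fun n => G (E ∩ g ⁻¹' {n})) (G E) := by
    have := G.m_iUnion hm hd
    rwa [hU] at this
  have h2 : HasSum (fun n => μ.real (E ∩ g ⁻¹' {n}) • y n) (∫ t in E, y (g t) ∂μ) := by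
    have := hasSum_integral_iUnion hm hd hint.integrableOn
    rw [hU] at this
    convert! this using 2 with n
    rw [setIntegral_congr_fun (g := fun _ => y n) (hm n) fun t ht => by
      have : g t = n := ht.2
      simp [this], setIntegral_const]
  have h3 : HasSum (fun n => ε * μ.real (E ∩ g ⁻¹' {n})) (ε * μ.real E) := by
    have := (hasSum_integral_iUnion hm hd (integrable_const (1 : ℝ)).integrableOn (μ := μ)).mul_left ε
    simpa [hU] using this
  have h4 := h1.sub h2
  rw [← h4.tsum_eq, ← h3.tsum_eq]
  exact tsum_of_norm_bounded h3.summable.hasSum fun n => hle n _ Set.inter_subset_right (hm n)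

end Denseness

/-! ### Restrictions, multiples and images of measures -/

section Permanence
variable {Ω Y : Type*} [MeasurableSpace Ω] {μ : Measure Ω} [NormedAddCommGroup Y] [NormedSpace ℝ Y]

theorem BoundedRNP.restrict (h : BoundedRNP Y μ) {A : Set Ω} (hA : MeasurableSet A) :
    BoundedRNP Y (μ.restrict A) := by
  intro G hG
  obtain ⟨g, hg, hGg⟩ := h G fun E => (hG E).trans (Measure.restrict_apply_le A E)
  refine ⟨g, hg.restrict, fun E hE => ?_⟩
  have h0 : G (E \ A) = 0 := by
    have := hG (E \ A)
    rw [Measure.restrict_apply (hE.diff hA), Set.sdiff_inter_self, measure_empty] at this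
    simpa using this
  have h1 : G E = G (E ∩ A) := by
    rw [← add_zero (G (E ∩ A)), ← h0, ← VectorMeasure.of_union Set.disjoint_sdiff_inter.symm
      (hE.inter hA) (hE.diff hA), Set.inter_union_sdiff]
  rw [h1, hGg _ (hE.inter hA), Measure.restrict_restrict hE]

theorem BoundedRNP.smul_measure (h : BoundedRNP Y μ) {c : ENNReal} (hc0 : c ≠ 0) (hc : c ≠ ⊤) :
    BoundedRNP Y (c • μ) := by
  intro G hG
  have hr : 0 < c.toReal := ENNReal.toReal_pos hc0 hc
  obtain ⟨g, hg, hGg⟩ := h (c.toReal⁻¹ • G) fun E => by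
    rw [smul_apply, enorm_smul, Real.enorm_of_nonneg (by positivity), ENNReal.ofReal_inv_of_pos hr,
      ENNReal.ofReal_toReal hc]
    refine (mul_le_mul_right (hG E) _).trans_eq ?_
    rw [Measure.smul_apply, smul_eq_mul, ← mul_assoc, ENNReal.inv_mul_cancel hc0 hc, one_mul]
  refine ⟨g, hg.smul_measure hc, fun E hE => ?_⟩
  rw [Measure.restrict_smul, integral_smul_measure, ← hGg E hE, smul_apply,
    smul_inv_smul₀ hr.ne']

/-- `BoundedRNP` passes to image measures. A vector measure `G` dominated by the image of `μ` under `φ`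
is pulled back to `Ω` as `E ↦ ∫ h_E dG`, where `h_E` is the conditional probability of `E` given
`φ`, obtained as a Radon–Nikodým derivative. A density of the pull-back, conditioned on `φ`, factors
through `φ` and is then a density of `G`. -/
theorem BoundedRNP.map [CompleteSpace Y] [IsFiniteMeasure μ] (h : BoundedRNP Y μ)
    {K : Type*} [MeasurableSpace K] {φ : Ω → K} (hφ : Measurable φ) : BoundedRNP Y (μ.map φ) := by
  classical
  intro G hG
  obtain ⟨S, hS1, hS⟩ := exists_clm_oneOn (𝕜 := ℝ) G hG
  -- `d E` is the conditional probability of `E` given `φ`, as a function on `K`.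
  let d : Set Ω → K → ENNReal := fun E => ((μ.restrict E).map φ).rnDeriv (μ.map φ)
  have hle : ∀ E, (μ.restrict E).map φ ≤ μ.map φ := fun E => Measure.map_mono Measure.restrict_le_self hφ
  have hdint : ∀ E, Integrable (fun x => (d E x).toReal) (μ.map φ) := fun E =>
    Measure.integrable_toReal_rnDeriv
  let D : Set Ω → Lp ℝ 1 (μ.map φ) := fun E => (hdint E).toL1 _
  have hDnorm : ∀ E, ‖D E‖ = μ.real E := by
    intro E
    have : ∀ x, ‖(d E x).toReal‖ = (d E x).toReal := fun x => Real.norm_of_nonneg ENNReal.toReal_nonneg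
    simp only [D, L1.norm_of_fun_eq_integral_norm, this]
    rw [Measure.integral_toReal_rnDeriv (Measure.absolutelyContinuous_of_le (hle E)),
      measureReal_def, Measure.map_apply hφ .univ]
    simp [measureReal_def]
  have hDadd : ∀ E F, MeasurableSet F → Disjoint E F → D (E ∪ F) = D E + D F := by
    intro E F hF hEF
    simp only [D]
    rw [← Integrable.toL1_add]
    refine (Integrable.toL1_eq_toL1_iff _ _ _ _).2 ?_
    have h1 := Measure.rnDeriv_add' ((μ.restrict E).map φ) ((μ.restrict F).map φ) (μ.map φ)
    rw [← Measure.map_add _ _ hφ, ← Measure.restrict_union hEF hF] at h1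
    filter_upwards [h1, Measure.rnDeriv_lt_top ((μ.restrict E).map φ) (μ.map φ),
      Measure.rnDeriv_lt_top ((μ.restrict F).map φ) (μ.map φ)] with x hx hE1 hF1
    simp only [d, Pi.add_apply] at hx ⊢
    rw [hx, ENNReal.toReal_add hE1.ne hF1.ne]
  have hDpre : ∀ F (hF : MeasurableSet F), D (φ ⁻¹' F) = oneOn ℝ (μ.map φ) hF := by
    intro F hF
    refine Lp.ext ?_
    have h1 := Measure.rnDeriv_restrict_self (μ.map φ) hF
    rw [Measure.restrict_map hφ hF] at h1
    filter_upwards [(hdint (φ ⁻¹' F)).coeFn_toL1, h1, indicatorConstLp_coeFn (μ := μ.map φ) (p := 1)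
      (hs := hF) (hμs := measure_ne_top _ F) (c := (1 : ℝ))] with x hx1 hx2 hx3
    rw [oneOn, hx3]
    refine hx1.trans ?_
    simp only [d, hx2]
    by_cases hx : x ∈ F <;> simp [hx]
  let H : VectorMeasure Ω Y := VectorMeasure.of_additive_of_le_measure (μ := μ)
    (fun E => if MeasurableSet E then S (D E) else 0)
    (fun E => by
      split_ifs with hE
      · rw [← ofReal_norm, ← ofReal_measureReal (μ := μ) (s := E), ← hDnorm]
        refine ENNReal.ofReal_le_ofReal ((S.le_opNorm _).trans ?_)
        exact mul_le_of_le_one_left (norm_nonneg _) hS1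
      · simp)
    (fun E F hE hF hEF => by
      simp only [hE, hF, hE.union hF, if_true]
      rw [hDadd E F hF hEF, map_add])
    (fun E hE => by simp [hE])
  have hH : ∀ E, H E = if MeasurableSet E then S (D E) else 0 := fun E => rfl
  obtain ⟨g, hg, hHg⟩ := h H fun E => by
    rw [hH]
    split_ifs with hE
    · rw [← ofReal_norm, ← ofReal_measureReal (μ := μ) (s := E), ← hDnorm]
      refine ENNReal.ofReal_le_ofReal ((S.le_opNorm _).trans ?_)
      exact mul_le_of_le_one_left (norm_nonneg _) hS1
    · simp
  obtain ⟨g', hg', hgg'⟩ := StronglyMeasurable.exists_eq_measurable_comp (f := φ)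
    (stronglyMeasurable_condExp (f := g) (μ := μ) (m := MeasurableSpace.comap φ inferInstance))
  refine ⟨g', ?_, fun F hF => ?_⟩
  · rw [integrable_map_measure hg'.aestronglyMeasurable hφ.aemeasurable, ← hgg']
    exact integrable_condExp
  · rw [setIntegral_map hF hg'.aestronglyMeasurable hφ.aemeasurable]
    have : G F = H (φ ⁻¹' F) := by rw [hH, if_pos (hφ hF), hDpre F hF, hS]
    rw [this, hHg _ (hφ hF), ← setIntegral_condExp hφ.comap_le hg ⟨F, hF, rfl⟩, hgg']
    rfl

end Permanence

/-! ### Measures as images of an atomless measure -/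

/-- A set of positive measure without atoms has subsets of arbitrarily small positive measure, found
by repeatedly passing to the smaller part of a nontrivial splitting. -/
theorem exists_subset_measure_le {Ω : Type*} [MeasurableSpace Ω] {μ : Measure Ω}
    [IsFiniteMeasure μ] {E : Set Ω} (hE : ∀ A ⊆ E, ¬ IsAtomSet μ A) {ε : ENNReal} (hε : 0 < ε)
    {A : Set Ω} (hAE : A ⊆ E) (hA : MeasurableSet A) (hA0 : 0 < μ A) :
    ∃ B ⊆ A, MeasurableSet B ∧ 0 < μ B ∧ μ B ≤ ε := by
  have hstep : ∀ n : ℕ, ∃ B ⊆ A, MeasurableSet B ∧ 0 < μ B ∧ 2 ^ n * μ B ≤ μ A := by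
    intro n
    induction n with
    | zero => exact ⟨A, subset_rfl, hA, hA0, by simp⟩
    | succ n ih =>
      obtain ⟨B, hBA, hB, hB0, hle⟩ := ih
      obtain ⟨C, hC, hCB, hC0, hC1⟩ : ∃ C, MeasurableSet C ∧ C ⊆ B ∧ μ C ≠ 0 ∧ μ (B \ C) ≠ 0 := by
        by_contra! hcon
        refine hE B (hBA.trans hAE) ⟨hB, hB0, fun C hC hCB => ?_⟩
        by_cases h : μ C = 0
        exacts [Or.inl h, Or.inr (hcon C hC hCB h)]
      have hsum : μ C + μ (B \ C) = μ B := by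
        have := measure_inter_add_sdiff (μ := μ) B hC
        rwa [Set.inter_eq_right.2 hCB] at this
      have key : ∀ D ⊆ B, MeasurableSet D → μ D ≠ 0 → 2 * μ D ≤ μ B →
          ∃ B ⊆ A, MeasurableSet B ∧ 0 < μ B ∧ 2 ^ (n + 1) * μ B ≤ μ A := by
        intro D hDB hD hD0 hD2
        refine ⟨D, hDB.trans hBA, hD, pos_iff_ne_zero.2 hD0, le_trans ?_ hle⟩
        rw [pow_succ, mul_assoc]
        gcongr
      rcases le_total (μ C) (μ (B \ C)) with h | h
      · exact key C hCB hC hC0 (by rw [two_mul, ← hsum]; gcongr)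
      · exact key (B \ C) Set.sdiff_subset (hB.diff hC) hC1 (by rw [two_mul, ← hsum]; gcongr)
  obtain ⟨n, hn⟩ := ENNReal.exists_nat_mul_gt hε.ne' (measure_ne_top μ A)
  obtain ⟨B, hBA, hB, hB0, hle⟩ := hstep n
  refine ⟨B, hBA, hB, hB0, ?_⟩
  by_contra! hlt
  have h1 : (n : ENNReal) * ε ≤ 2 ^ n * μ B := by
    gcongr
    exact_mod_cast Nat.lt_two_pow_self.le
  exact absurd (h1.trans hle) (not_le.2 hn)

/-- On an atomless set there is a measurable function whose fibres are null: its value at `ω` encodes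
the members that contain `ω` of countable partitions into smaller and smaller sets. -/
theorem exists_measurable_map_singleton_eq_zero {Ω : Type*} [MeasurableSpace Ω] {μ : Measure Ω}
    [IsFiniteMeasure μ] {E : Set Ω} (hEm : MeasurableSet E) (hE : ∀ A ⊆ E, ¬ IsAtomSet μ A) :
    ∃ Z : Ω → ℝ, Measurable Z ∧ ∀ x, μ.restrict E (Z ⁻¹' {x}) = 0 := by
  have hpos : ∀ n : ℕ, (0 : ENNReal) < ((n : ENNReal) + 1)⁻¹ := fun n =>
    ENNReal.inv_pos.2 (by finiteness)
  choose g hg hgle using fun n : ℕ =>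
    exists_measurable_nat_fiber (μ.restrict E) (fun B => μ.restrict E B ≤ ((n : ENNReal) + 1)⁻¹)
      (fun A B _ _ hAB hB => (measure_mono hAB).trans hB) (fun A _ hA0 => hA0.le.trans zero_le)
      (fun A hA hA0 => by
        rw [Measure.restrict_apply hA] at hA0
        obtain ⟨B, hBA, hB, hB0, hle⟩ := exists_subset_measure_le hE (hpos n)
          Set.inter_subset_right (hA.inter hEm) hA0
        have hBE : B ∩ E = B := Set.inter_eq_left.2 (hBA.trans Set.inter_subset_right)
        refine ⟨B, hBA.trans Set.inter_subset_left, hB, ?_, ?_⟩ <;>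
          rw [Measure.restrict_apply hB, hBE] <;> assumption)
  let X : Ω → ℕ → ℕ := fun ω n => g n ω
  have hX : Measurable X := measurable_pi_lambda _ hg
  have hemb := measurableEmbedding_embeddingReal (ℕ → ℕ)
  refine ⟨embeddingReal (ℕ → ℕ) ∘ X, hemb.measurable.comp hX, fun x => ?_⟩
  by_cases hx : ∃ ω, embeddingReal (ℕ → ℕ) (X ω) = x
  · obtain ⟨ω, rfl⟩ := hx
    refine le_antisymm (ge_of_tendsto' ENNReal.tendsto_inv_nat_nhds_zero fun n => ?_) zero_le
    refine le_trans (measure_mono ?_) ((hgle n (X ω n)).trans ?_)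
    · intro ω' hω'
      exact congrFun (hemb.injective hω') n
    · exact ENNReal.inv_le_inv.2 le_self_add
  · have : embeddingReal (ℕ → ℕ) ∘ X ⁻¹' {x} = ∅ := by
      ext ω
      simp only [Set.mem_preimage, Set.mem_singleton_iff, Set.mem_empty_iff_false, iff_false]
      exact fun h => hx ⟨ω, h⟩
    rw [this, measure_empty]

/-- A probability measure on `ℝ` without point masses is mapped to the uniform distribution by its
cumulative distribution function. -/
theorem exists_measurable_map_eq_volume (ρ : Measure ℝ) [IsProbabilityMeasure ρ]
    (hρ : ∀ x, ρ {x} = 0) :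
    ∃ U : ℝ → unitInterval, Measurable U ∧ ρ.map U = volume := by
  let F := ProbabilityTheory.cdf ρ
  have hmono : Monotone F := ProbabilityTheory.monotone_cdf ρ
  have hcont : Continuous F := by
    rw [continuous_iff_continuousAt]
    intro x
    rw [hmono.continuousAt_iff_leftLim_eq_rightLim]
    have h1 := hρ x
    rw [← ProbabilityTheory.measure_cdf ρ, StieltjesFunction.measure_singleton,
      ENNReal.ofReal_eq_zero] at h1
    have h2 : Function.leftLim F x ≤ F x := hmono.leftLim_le le_rfl
    have h3 : Function.rightLim F x = F x := F.rightLim_eq x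
    rw [h3]
    exact le_antisymm h2 (by linarith)
  have hex : ∀ t : ℝ, 0 < t → t < 1 → ∃ a, F a = t := by
    intro t h0 h1
    refine mem_range_of_exists_le_of_exists_ge hcont ?_ ?_
    · exact ((ProbabilityTheory.tendsto_cdf_atBot ρ).eventually (gt_mem_nhds h0)).exists.imp
        fun _ => le_of_lt
    · exact ((ProbabilityTheory.tendsto_cdf_atTop ρ).eventually (lt_mem_nhds h1)).exists.imp
        fun _ => le_of_lt
  have hreal : ∀ a, ρ.real (Set.Iic a) = F a := fun a => (ProbabilityTheory.cdf_eq_real ρ a).symm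
  let U : ℝ → unitInterval := fun x =>
    ⟨F x, ProbabilityTheory.cdf_nonneg ρ x, ProbabilityTheory.cdf_le_one ρ x⟩
  have hU : Measurable U := hcont.measurable.subtype_mk
  refine ⟨U, hU, ?_⟩
  have : IsProbabilityMeasure (ρ.map U) := Measure.isProbabilityMeasure_map hU.aemeasurable
  refine Measure.ext_of_Iic _ _ fun t => ?_
  rw [unitInterval.volume_Iic, Measure.map_apply hU measurableSet_Iic, ← ofReal_measureReal]
  congr 1
  refine le_antisymm ?_ ?_
  · refine le_of_forall_gt_imp_ge_of_dense fun s hs => ?_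
    rcases le_or_gt 1 s with h1 | h1
    · exact measureReal_le_one.trans h1
    · obtain ⟨b, hb⟩ := hex s (t.2.1.trans_lt hs) h1
      rw [← hb, ← hreal]
      refine measureReal_mono fun x hx => ?_
      by_contra hxb
      have h2 : F x ≤ t := hx
      have h3 : F b ≤ F x := hmono (not_le.1 hxb).le
      linarith
  · refine le_of_forall_lt_imp_le_of_dense fun s hs => ?_
    rcases le_or_gt s 0 with h0 | h0
    · exact h0.trans measureReal_nonneg
    · obtain ⟨a, ha⟩ := hex s h0 (hs.trans_le t.2.2)
      rw [← ha, ← hreal]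
      refine measureReal_mono fun x hx => ?_
      have h2 : F x ≤ F a := hmono hx
      exact (h2.trans (ha.trans_lt hs).le : F x ≤ t)

/-- If `μ` is not purely atomic, then its normalised restriction to a suitable set can be mapped to
any probability measure on a standard Borel space. -/
theorem exists_map_eq_of_not_purelyAtomic {Ω : Type*} [MeasurableSpace Ω] {μ : Measure Ω}
    [IsFiniteMeasure μ] (hμ : ¬ PurelyAtomic μ) :
    ∃ E, MeasurableSet E ∧ μ E ≠ 0 ∧ ∀ (K : Type) [MeasurableSpace K] [StandardBorelSpace K]
      (ν : Measure K) [IsProbabilityMeasure ν],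
      ∃ φ : Ω → K, Measurable φ ∧ ((μ E)⁻¹ • μ.restrict E).map φ = ν := by
  simp only [PurelyAtomic, not_forall] at hμ
  obtain ⟨E, hEm, hE0, hE⟩ := hμ
  push Not at hE
  obtain ⟨Z, hZ, hZ0⟩ := exists_measurable_map_singleton_eq_zero hEm hE
  have hp : IsProbabilityMeasure ((μ E)⁻¹ • μ.restrict E) := by
    refine ⟨?_⟩
    rw [Measure.smul_apply, Measure.restrict_apply_univ, smul_eq_mul,
      ENNReal.inv_mul_cancel hE0.ne' (measure_ne_top _ _)]
  have hpZ := Measure.isProbabilityMeasure_map (μ := (μ E)⁻¹ • μ.restrict E) hZ.aemeasurable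
  obtain ⟨U, hU, hUmap⟩ := exists_measurable_map_eq_volume (((μ E)⁻¹ • μ.restrict E).map Z)
    fun x => by
      rw [Measure.map_apply hZ (measurableSet_singleton x), Measure.smul_apply, hZ0, smul_zero]
  refine ⟨E, hEm, hE0.ne', fun K _ _ ν _ => ?_⟩
  have : Nonempty K := nonempty_of_isProbabilityMeasure ν
  obtain ⟨f, hf, hfmap⟩ := Measure.exists_measurable_map_eq ν
  refine ⟨f ∘ U ∘ Z, hf.comp (hU.comp hZ), ?_⟩
  rw [← Measure.map_map hf (hU.comp hZ), ← Measure.map_map hU hZ, hUmap, hfmap]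

/-! ### From the Cantor space to all finite measures -/

theorem eLpNorm_condExp_sub_le {Ω Y : Type*} {m m0 : MeasurableSpace Ω} {ν : Measure[m0] Ω}
    [NormedAddCommGroup Y] [NormedSpace ℝ Y] [CompleteSpace Y] {f g : Ω → Y} (hf : Integrable f ν)
    (hg : Integrable g ν) : eLpNorm (ν[f|m] - ν[g|m]) 1 ν ≤ eLpNorm (f - g) 1 ν := by
  rw [← eLpNorm_congr_ae (condExp_sub hf hg m)]
  exact eLpNorm_condExp_le_eLpNorm _ le_rfl

/-- Lévy's upward theorem in `L₁` for functions with values in a Banach space, deduced from the real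
case by density of the simple functions. -/
theorem tendsto_eLpNorm_condExp_vector {Ω Y : Type*} {m0 : MeasurableSpace Ω} {ν : Measure Ω}
    [IsFiniteMeasure ν] [NormedAddCommGroup Y] [NormedSpace ℝ Y] [CompleteSpace Y] (ℱ : Filtration ℕ m0) {f : Ω → Y} (hf : Integrable f ν) :
    Tendsto (fun n => eLpNorm (ν[f|ℱ n] - ν[f|⨆ n, ℱ n]) 1 ν) atTop (𝓝 0) := by
  refine Integrable.induction
    (P := fun f => Tendsto (fun n => eLpNorm (ν[f|ℱ n] - ν[f|⨆ n, ℱ n]) 1 ν) atTop (𝓝 0))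
    ?_ ?_ ?_ ?_ hf
  · intro c s hs _
    let L : ℝ →L[ℝ] Y := ContinuousLinearMap.toSpanSingleton ℝ c
    have hint : Integrable (s.indicator fun _ => (1 : ℝ)) ν :=
      (integrable_const 1).indicator hs
    have hL : L ∘ (s.indicator fun _ => (1 : ℝ)) = s.indicator fun _ => c := by
      ext x
      by_cases hx : x ∈ s <;> simp [L, hx]
    have hcond : ∀ m : MeasurableSpace Ω, ν[s.indicator fun _ => c|m] =ᵐ[ν]
        fun x => ν[s.indicator fun _ => (1 : ℝ)|m] x • c := by
      intro m
      have := L.comp_condExp_comm hint (m := m)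
      rw [hL] at this
      exact this.symm
    have hreal := tendsto_eLpNorm_condExp (ℱ := ℱ) (μ := ν) (s.indicator fun _ => (1 : ℝ))
    have h2 : Tendsto (fun n => ‖c‖ₑ * eLpNorm (ν[s.indicator fun _ => (1 : ℝ)|ℱ n] -
        ν[s.indicator fun _ => (1 : ℝ)|⨆ n, ℱ n]) 1 ν) atTop (𝓝 0) := by
      simpa using ENNReal.Tendsto.const_mul hreal (Or.inr (enorm_ne_top (x := c)))
    refine h2.congr fun n => ?_
    rw [eLpNorm_one_eq_lintegral_enorm, eLpNorm_one_eq_lintegral_enorm,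
      ← lintegral_const_mul' _ _ enorm_ne_top]
    refine lintegral_congr_ae ?_
    filter_upwards [hcond (ℱ n), hcond (⨆ n, ℱ n)] with x h1 h2
    rw [Pi.sub_apply, Pi.sub_apply, h1, h2, ← sub_smul, enorm_smul, mul_comm]
  · intro f g _ hf hg hf' hg'
    refine tendsto_of_tendsto_of_tendsto_of_le_of_le tendsto_const_nhds
      (by simpa using hf'.add hg') (fun _ => zero_le) fun n => ?_
    have h1 : ν[f + g|ℱ n] - ν[f + g|⨆ n, ℱ n] =ᵐ[ν]
        (ν[f|ℱ n] - ν[f|⨆ n, ℱ n]) + (ν[g|ℱ n] - ν[g|⨆ n, ℱ n]) := by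
      filter_upwards [condExp_add hf hg (ℱ n), condExp_add hf hg (⨆ n, ℱ n)] with x h1 h2
      simp only [Pi.sub_apply, Pi.add_apply] at h1 h2 ⊢
      rw [h1, h2]
      abel
    rw [eLpNorm_congr_ae h1]
    exact eLpNorm_add_le ((integrable_condExp.sub integrable_condExp).1)
      ((integrable_condExp.sub integrable_condExp).1) le_rfl
  · refine isClosed_of_closure_subset fun f hf => ?_
    refine ENNReal.tendsto_nhds_zero.2 fun ε hε => ?_
    have hε3 : 0 < ε / 3 := ENNReal.div_pos hε.ne' (by simp)
    obtain ⟨f', hf', hd⟩ := EMetric.mem_closure_iff.1 hf (ε / 3) hε3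
    have hfi := L1.integrable_coeFn f
    have hfi' := L1.integrable_coeFn f'
    have hle : eLpNorm (⇑f - ⇑f') 1 ν ≤ ε / 3 := by
      rw [← Lp.edist_def]
      exact hd.le
    have hle' : eLpNorm (⇑f' - ⇑f) 1 ν ≤ ε / 3 := by
      rw [← Lp.edist_def, edist_comm]
      exact hd.le
    filter_upwards [ENNReal.tendsto_nhds_zero.1 hf' (ε / 3) hε3] with n hn
    have hsplit : ν[f|ℱ n] - ν[f|⨆ n, ℱ n] = (ν[f|ℱ n] - ν[f'|ℱ n]) +
        ((ν[f'|ℱ n] - ν[f'|⨆ n, ℱ n]) + (ν[f'|⨆ n, ℱ n] - ν[f|⨆ n, ℱ n])) := by abel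
    have hm : ∀ (m m' : MeasurableSpace Ω) (u v : Ω → Y),
        AEStronglyMeasurable[m0] (ν[u|m] - ν[v|m']) ν := fun m m' u v =>
      ((integrable_condExp (m := m) (f := u)).sub (integrable_condExp (m := m') (f := v))).1
    rw [hsplit]
    refine (eLpNorm_add_le (hm _ _ _ _) ((hm _ _ _ _).add (hm _ _ _ _)) le_rfl).trans ?_
    refine (add_le_add ((eLpNorm_condExp_sub_le hfi hfi').trans hle)
      ((eLpNorm_add_le (hm _ _ _ _) (hm _ _ _ _) le_rfl).trans
        (add_le_add hn ((eLpNorm_condExp_sub_le hfi' hfi).trans hle')))).trans_eq ?_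
    rw [← add_assoc, ENNReal.add_thirds]
  · intro f g hfg _ hf
    refine hf.congr fun n => ?_
    exact eLpNorm_congr_ae ((condExp_congr_ae hfg).sub (condExp_congr_ae hfg))

/-- If all probability measures on the Cantor space satisfy `BoundedRNP`, then a vector measure
dominated by a probability measure has a density on each countably generated sub-σ-algebra: the
generating sets define a map to the Cantor space, and the density is pulled back from there. -/
theorem exists_density_generateFrom_countable {Ω Y : Type*} [m0 : MeasurableSpace Ω]
    [NormedAddCommGroup Y] [NormedSpace ℝ Y] {ν : Measure Ω} [IsProbabilityMeasure ν]
    (hK : ∀ (ρ : Measure (ℕ → Bool)) [IsProbabilityMeasure ρ], BoundedRNP Y ρ)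
    (G : VectorMeasure Ω Y) (hG : ∀ E, ‖G E‖ₑ ≤ ν E) {𝒞 : Set (Set Ω)} (h𝒞 : 𝒞.Countable)
    (hm : ∀ s ∈ 𝒞, MeasurableSet s) :
    ∃ g : Ω → Y, StronglyMeasurable[MeasurableSpace.generateFrom 𝒞] g ∧ Integrable g ν ∧
      ∀ E, MeasurableSet[MeasurableSpace.generateFrom 𝒞] E → G E = ∫ t in E, g t ∂ν := by
  classical
  obtain ⟨s, hs⟩ := (h𝒞.insert ∅).exists_eq_range (Set.insert_nonempty _ _)
  have hsm : ∀ n, MeasurableSet[MeasurableSpace.generateFrom 𝒞] (s n) := by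
    intro n
    have : s n ∈ insert ∅ 𝒞 := hs ▸ Set.mem_range_self n
    rcases this with h | h
    · rw [h]
      exact @MeasurableSet.empty _ (MeasurableSpace.generateFrom 𝒞)
    · exact MeasurableSpace.measurableSet_generateFrom h
  have hle : MeasurableSpace.generateFrom 𝒞 ≤ m0 := MeasurableSpace.generateFrom_le hm
  let π : Ω → ℕ → Bool := fun ω n => decide (ω ∈ s n)
  have hπ : Measurable[MeasurableSpace.generateFrom 𝒞] π := by
    refine @measurable_pi_lambda _ _ _ (MeasurableSpace.generateFrom 𝒞) _ _ fun n => ?_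
    refine @measurable_to_bool _ (MeasurableSpace.generateFrom 𝒞) _ ?_
    convert hsm n using 1
    ext ω
    simp [π]
  have hπ0 : Measurable π := hπ.mono hle le_rfl
  have hcomap : MeasurableSpace.generateFrom 𝒞 ≤ MeasurableSpace.comap π inferInstance := by
    refine MeasurableSpace.generateFrom_le fun t ht => ?_
    obtain ⟨n, rfl⟩ : t ∈ Set.range s := hs ▸ Set.mem_insert_of_mem _ ht
    refine ⟨(fun x => x n) ⁻¹' {true}, measurable_pi_apply n (measurableSet_singleton true), ?_⟩
    ext ω
    simp [π]
  have := Measure.isProbabilityMeasure_map (μ := ν) hπ0.aemeasurable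
  obtain ⟨g, hg, hGg⟩ := hK (ν.map π) (G.map π) fun F => by
    by_cases hF : MeasurableSet F
    · rw [VectorMeasure.map_apply _ hπ0 hF, Measure.map_apply hπ0 hF]
      exact hG _
    · simp [VectorMeasure.not_measurable _ hF]
  have hg' : StronglyMeasurable (hg.1.mk g) := hg.1.stronglyMeasurable_mk
  have hgi : Integrable (hg.1.mk g) (ν.map π) := hg.congr hg.1.ae_eq_mk
  refine ⟨hg.1.mk g ∘ π, hg'.comp_measurable hπ, hgi.comp_measurable hπ0, fun E hE => ?_⟩
  obtain ⟨F, hF, rfl⟩ := hcomap E hE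
  rw [← VectorMeasure.map_apply _ hπ0 hF, hGg F hF,
    setIntegral_congr_ae hF (hg.1.ae_eq_mk.mono fun x hx _ => hx),
    setIntegral_map hF hg'.aestronglyMeasurable hπ0.aemeasurable]
  rfl

/-- If all probability measures on the Cantor space satisfy `BoundedRNP`, then so do all probability
measures. The densities `g i` on the σ-algebras generated by countable families `i` of measurable
sets form a net that is Cauchy in `L₁`, since otherwise Lévy's upward theorem would fail along some
increasing sequence. As the index set is closed under countable unions, the net is eventually
constant. -/
theorem boundedRNP_of_cantor {Ω Y : Type*} [m0 : MeasurableSpace Ω]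
    [NormedAddCommGroup Y] [NormedSpace ℝ Y] [CompleteSpace Y] (ν : Measure Ω)
    [IsProbabilityMeasure ν]
    (hK : ∀ (ρ : Measure (ℕ → Bool)) [IsProbabilityMeasure ρ], BoundedRNP Y ρ) :
    BoundedRNP Y ν := by
  intro G hG
  let I := {𝒞 : Set (Set Ω) // 𝒞.Countable ∧ ∀ s ∈ 𝒞, MeasurableSet s}
  let σ : I → MeasurableSpace Ω := fun 𝒞 => MeasurableSpace.generateFrom 𝒞.1
  have hσ : ∀ i, σ i ≤ m0 := fun i => MeasurableSpace.generateFrom_le i.2.2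
  have hmono : ∀ {i j : I}, i.1 ⊆ j.1 → σ i ≤ σ j := fun h => MeasurableSpace.generateFrom_mono h
  choose g hgm hgi hGg using fun i : I => exists_density_generateFrom_countable hK G hG i.2.1 i.2.2
  have htower : ∀ {i j : I}, i.1 ⊆ j.1 → g i =ᵐ[ν] ν[g j|σ i] := by
    intro i j hij
    refine ae_eq_condExp_of_forall_setIntegral_eq (hσ i) (hgi j)
      (fun _ _ _ => (hgi i).integrableOn) (fun s hs _ => ?_) (hgm i).aestronglyMeasurable
    rw [← hGg i s hs, ← hGg j s (hmono hij s hs)]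
  -- The countable union of a sequence of countable families.
  let U : (ℕ → I) → I := fun i => ⟨⋃ n, (i n).1, Set.countable_iUnion fun n => (i n).2.1,
    fun s hs => by
      obtain ⟨n, hn⟩ := Set.mem_iUnion.1 hs
      exact (i n).2.2 s hn⟩
  have hU : ∀ (i : ℕ → I) n, (i n).1 ⊆ (U i).1 := fun i n =>
    Set.subset_iUnion (fun n => (i n).1) n
  have hsubm : ∀ i j, AEStronglyMeasurable (g i - g j) ν := fun i j => ((hgi i).sub (hgi j)).1
  have hcauchy : ∀ ε : ENNReal, 0 < ε → ∃ i : I, ∀ j : I, i.1 ⊆ j.1 →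
      eLpNorm (g j - g i) 1 ν ≤ ε := by
    intro ε hε
    by_contra! hcon
    choose next hnext hbig using hcon
    -- An increasing sequence of families along which the densities do not converge.
    let i : ℕ → I := fun n => next^[n] ⟨∅, Set.countable_empty, by simp⟩
    have hsucc : ∀ n, i (n + 1) = next (i n) := fun n => Function.iterate_succ_apply' _ _ _
    have himono : Monotone fun n => (i n).1 := monotone_nat_of_le_succ fun n => by
      simp only [hsucc]
      exact hnext (i n)
    let ℱ : Filtration ℕ m0 := ⟨fun n => σ (i n), fun a b hab => hmono (himono hab), fun n => hσ _⟩
    have hsup : ⨆ n, ℱ n = σ (U i) := MeasurableSpace.iSup_generateFrom _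
    have hlim := tendsto_eLpNorm_condExp_vector ℱ (hgi (U i)) (ν := ν)
    rw [hsup] at hlim
    have hlim' : Tendsto (fun n => eLpNorm (g (i n) - g (U i)) 1 ν) atTop (𝓝 0) := by
      refine hlim.congr fun n => eLpNorm_congr_ae ?_
      exact (htower (hU i n)).symm.sub (htower subset_rfl).symm
    have hlim2 := ((tendsto_add_atTop_iff_nat 1).2 hlim').add hlim'
    rw [add_zero] at hlim2
    obtain ⟨n, hn⟩ := (hlim2.eventually (gt_mem_nhds hε)).exists
    refine absurd (hbig (i n)) (not_lt.2 (le_trans ?_ hn.le))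
    rw [← hsucc, ← sub_add_sub_cancel (g (i (n + 1))) (g (U i)) (g (i n))]
    refine (eLpNorm_add_le (hsubm _ _) (hsubm _ _) le_rfl).trans_eq ?_
    rw [eLpNorm_sub_comm (g (U i))]
  have hpos : ∀ n : ℕ, (0 : ENNReal) < ((n : ENNReal))⁻¹ := fun n => ENNReal.inv_pos.2 (by finiteness)
  choose i hi using fun n : ℕ => hcauchy _ (hpos n)
  have hstable : ∀ j : I, (U i).1 ⊆ j.1 → g j =ᵐ[ν] g (U i) := by
    intro j hj
    have hle : ∀ n : ℕ, eLpNorm (g j - g (U i)) 1 ν ≤ (n : ENNReal)⁻¹ + (n : ENNReal)⁻¹ := by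
      intro n
      rw [← sub_add_sub_cancel (g j) (g (i n)) (g (U i))]
      refine (eLpNorm_add_le (hsubm _ _) (hsubm _ _) le_rfl).trans ?_
      rw [eLpNorm_sub_comm (g (i n))]
      exact add_le_add (hi n j ((hU i n).trans hj)) (hi n _ (hU i n))
    have h0 : eLpNorm (g j - g (U i)) 1 ν = 0 := by
      refine le_antisymm (ge_of_tendsto' (x := atTop) ?_ hle) zero_le
      simpa using ENNReal.tendsto_inv_nat_nhds_zero.add ENNReal.tendsto_inv_nat_nhds_zero
    exact (sub_ae_eq_zero _ _).1 ((eLpNorm_eq_zero_iff (hsubm _ _) one_ne_zero).1 h0)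
  refine ⟨g (U i), hgi _, fun E hE => ?_⟩
  -- Adding `E` to the family does not change the density.
  let j : I := ⟨insert E (U i).1, (U i).2.1.insert E, by
    rintro s (rfl | hs)
    exacts [hE, (U i).2.2 s hs]⟩
  rw [hGg j E (MeasurableSpace.measurableSet_generateFrom (Set.mem_insert _ _))]
  exact setIntegral_congr_ae hE ((hstable j (Set.subset_insert _ _)).mono fun x hx _ => hx)

theorem hasRNPWith_of_boundedRNP_variation {Ω Y : Type*} [MeasurableSpace Ω]
    [NormedAddCommGroup Y] [NormedSpace ℝ Y] (μ : Measure Ω) [IsFiniteMeasure μ]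
    (h : ∀ (ν : Measure Ω) [IsFiniteMeasure ν], BoundedRNP Y ν) : HasRNPWith Y μ := by
  intro G hGμ hvar
  have hfin : IsFiniteMeasure G.variation := ⟨hvar⟩
  obtain ⟨g, hg, hGg⟩ := h G.variation G G.enorm_measure_le_variation
  have hac : G.variation ≪ μ := by
    refine Measure.AbsolutelyContinuous.mk fun s hs h0 => ?_
    exact (G.variation_apply_eq_zero hs).2 fun t hts ht => hGμ t ht (measure_mono_null hts h0)
  refine ⟨fun t => (G.variation.rnDeriv μ t).toReal • g t,
    (integrable_rnDeriv_smul_iff hac).2 hg, fun E hE => ?_⟩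
  rw [hGg E hE, setIntegral_rnDeriv_smul hac hE]

theorem hasRNP_of_boundedRNP {Ω : Type u} [MeasurableSpace Ω] {μ : Measure Ω} [IsFiniteMeasure μ]
    (hμ : ¬ PurelyAtomic μ) {Y : Type v} [NormedAddCommGroup Y] [NormedSpace ℝ Y]
    [CompleteSpace Y] (h : BoundedRNP Y μ) : HasRNP.{v, w} Y := by
  obtain ⟨E, hE, hE0, hmap⟩ := exists_map_eq_of_not_purelyAtomic hμ
  have hcantor : ∀ (ρ : Measure (ℕ → Bool)) [IsProbabilityMeasure ρ], BoundedRNP Y ρ := by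
    intro ρ _
    obtain ⟨φ, hφ, rfl⟩ := hmap (ℕ → Bool) ρ
    have hc : (μ E)⁻¹ ≠ ⊤ := ENNReal.inv_ne_top.2 hE0
    have : IsFiniteMeasure ((μ E)⁻¹ • μ.restrict E) := (μ.restrict E).smul_finite hc
    exact ((h.restrict hE).smul_measure (ENNReal.inv_ne_zero.2 (measure_ne_top _ _)) hc).map hφ
  intro Ω' _ μ' _
  refine hasRNPWith_of_boundedRNP_variation μ' fun ν _ => ?_
  by_cases h0 : ν Set.univ = 0
  · intro G hG
    refine ⟨0, integrable_zero _ _ _, fun F _ => ?_⟩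
    have : ν F = 0 := measure_mono_null (Set.subset_univ F) h0
    simpa [this] using hG F
  · have hp : IsProbabilityMeasure ((ν Set.univ)⁻¹ • ν) := by
      refine ⟨?_⟩
      rw [Measure.smul_apply, smul_eq_mul, ENNReal.inv_mul_cancel h0 (measure_ne_top _ _)]
    have := (boundedRNP_of_cantor ((ν Set.univ)⁻¹ • ν) hcantor).smul_measure
      h0 (measure_ne_top _ _)
    rwa [smul_smul, ENNReal.mul_inv_cancel h0 (measure_ne_top _ _), one_smul] at this

end RangeExposing

theorem theorem3p9 {𝕜 : Type k} [RCLike 𝕜] {Ω : Type u} [MeasurableSpace Ω]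
    (μ : Measure Ω) [IsFiniteMeasure μ] (hμ : ¬ RangeExposing.PurelyAtomic μ)
    (Y : Type v) [NormedAddCommGroup Y] [NormedSpace ℝ Y] [NormedSpace 𝕜 Y] [IsScalarTower ℝ 𝕜 Y]
    [CompleteSpace Y]
    (hdense : Dense (RangeExposing.RSE 𝕜 (Lp 𝕜 1 μ) Y)) :
    RangeExposing.HasRNP.{v, w} Y :=
  RangeExposing.hasRNP_of_boundedRNP hμ (RangeExposing.boundedRNP_of_dense_RSE hdense)
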